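/- Let $\Gamma=\mathrm{SL}_2(\mathbb Z)$ act on the upper half-plane $\mathcal H$. For $k\in\mathbb Z$ let $M_k(\Gamma)$ be the complex vector space of modular forms of weight $k$: holomorphic functions $F:\mathcal H\to\mathbb C$ with $F\left(\frac{a\tau+b}{c\tau+d}\right)=(c\tau+d)^kF(\tau)$ for all $\begin{pmatrix}a&b\\c&d\end{pmatrix}\in\Gamma$ and $\tau\in\mathcal H$, such that $|F(\tau)|$ remains bounded as $\Im(\tau)\to\infty$. Let $S_k(\Gamma)\subset M_k(\Gamma)$ be the subspace of cusp forms, those with $F(\tau)\to0$ as $\Im(\tau)\to\infty$. Let $M_*(\Gamma)=\bigoplus_{k\in\mathbb Z}M_k(\Gamma)$, a graded $\mathbb C$-algebra under multiplication of functions, and $S_*(\Gamma)=\bigoplus_{k\in\mathbb Z}S_k(\Gamma)\subset M_*(\Gamma)$. For $k=4,6$ let $$G_k(\tau)=\sum_{(m,n)\in\mathbb Z^2\setminus\{(0,0)\}}(m\tau+n)^{-k}\in M_k(\Gamma).$$ Then: 1. $M_*(\Gamma)=\mathbb C[G_4,G_6]$ is the polynomial ring on $G_4$ and $G_6$: the $\mathbb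 C$-algebra homomorphism $\mathbb C[X,Y]\to M_*(\Gamma)$ sending $X\mapsto G_4$, $Y\mapsto G_6$ is bijective. 2. The space $S_{12}(\Gamma)$ is one-dimensional. It contains exactly one element $\Delta$ whose Fourier expansion in $q=e^{2\pi i\tau}$ begins with $\Delta=q+O(q^2)$; this $\Delta$ generates $S_{12}(\Gamma)$, and $S_*(\Gamma)=\Delta\,M_*(\Gamma)$. -/

import Mathlib

open UpperHalfPlane
open scoped MatrixGroups DirectSum

noncomputable section

namespace LevelOneForms

/-- The function `G_k(τ) = ∑_{(m,n) ∈ ℤ² ∖ {(0,0)}} (m τ + n)^(-k)`, a sum over all nonzero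
pairs of integers (not only the coprime ones). -/
def latticeSum (k : ℕ) (τ : ℍ) : ℂ :=
  ∑' v : {v : ℤ × ℤ // v ≠ 0}, (((v.1.1 : ℂ) * τ + v.1.2) ^ k)⁻¹

/-- The series defining `latticeSum` converges absolutely for `k ≥ 3`, so the sum is not a
junk value. -/
theorem summable_latticeSum {k : ℕ} (hk : 3 ≤ k) (τ : ℍ) :
    Summable fun v : {v : ℤ × ℤ // v ≠ 0} => (((v.1.1 : ℂ) * τ + v.1.2) ^ k)⁻¹ := by
  have h := (summable_prod_eisSummand hk τ).subtype {v : ℤ × ℤ | v ≠ 0}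
  refine h.congr fun v => ?_
  simp [EisensteinSeries.eisSummand]

theorem latticeSum_eq {k : ℕ} (hk : 3 ≤ k) :
    latticeSum k = ⇑((2 * riemannZeta k) • ModularForm.E hk) := by
  ext τ
  have h1 : latticeSum k τ = ∑' v : Fin 2 → ℤ, EisensteinSeries.eisSummand k v τ := by
    rw [← (finTwoArrowEquiv ℤ).symm.tsum_eq]
    have hs : Function.support
        (fun v : ℤ × ℤ => EisensteinSeries.eisSummand k ((finTwoArrowEquiv ℤ).symm v) τ) ⊆
        {v : ℤ × ℤ | v ≠ 0} := by
      intro v hv h0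
      apply hv
      have h0' : v = 0 := h0
      subst h0'
      have hk0 : k ≠ 0 := by omega
      simp [EisensteinSeries.eisSummand, hk0]
    rw [← tsum_subtype_eq_of_support_subset hs]
    refine tsum_congr fun v => ?_
    simp [EisensteinSeries.eisSummand]
  have h2 : ((2 * riemannZeta k) • ModularForm.E hk) τ
      = (2 * riemannZeta k) * ((1 / 2 : ℂ) * eisensteinSeries (N := 1) 0 k τ) := rfl
  rw [h1, h2, tsum_eisSummand_eq_riemannZeta_mul_eisensteinSeries hk τ]
  ring

/-- The Eisenstein series `G_k` (for `k ≥ 3`) as a modular form of weight `k` for `SL₂(ℤ)`;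
its underlying function is `latticeSum k`. -/
def G (k : ℕ) (hk : 3 ≤ k) : ModularForm 𝒮ℒ k :=
  ((2 * riemannZeta k) • ModularForm.E hk).copy (latticeSum k) (latticeSum_eq hk)

/-- The Eisenstein series of weight 4. -/
def G₄ : ModularForm 𝒮ℒ 4 := G 4 (by norm_num)

/-- The Eisenstein series of weight 6. -/
def G₆ : ModularForm 𝒮ℒ 6 := G 6 (by norm_num)

theorem G₄_apply (τ : ℍ) : G₄ τ = latticeSum 4 τ := rfl

theorem G₆_apply (τ : ℍ) : G₆ τ = latticeSum 6 τ := rfl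

/-- The graded `ℂ`-algebra `M_*` of modular forms for `SL₂(ℤ)`, the direct sum of the spaces
`M_k` over all integers `k`, with the pointwise product of forms. -/
abbrev MStar : Type := ⨁ k : ℤ, ModularForm 𝒮ℒ k

/-- The space `S_*` of cusp forms, the direct sum of the spaces `S_k` over all integers `k`,
inside `M_*`. -/
def SStar : Submodule ℂ MStar :=
  LinearMap.range
    (DirectSum.lmap fun k : ℤ =>
      (CuspForm.toModularFormₗ : CuspForm 𝒮ℒ k →ₗ[ℂ] ModularForm 𝒮ℒ k))

/-- The Fourier expansion `∑ a(n) q^n`, `q = exp (2 π i τ)`, of a cusp form begins with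
`q + O(q²)`, that is, `a(0) = 0` and `a(1) = 1`. -/
def BeginsWithQ {k : ℤ} (f : CuspForm 𝒮ℒ k) : Prop :=
  (qExpansion 1 f).coeff 0 = 0 ∧ (qExpansion 1 f).coeff 1 = 1

end LevelOneForms

end

open UpperHalfPlane ModularForm EisensteinSeries
open scoped MatrixGroups DirectSum

namespace LevelOneForms

/-! Independence: `G₆` vanishes at `i` and `G₄` does not. If `p(G₄, G₆) = 0`, evaluating at `i` with
weights rescaled by `t ^ k` gives `p(y, 0) = 0` for all `y ≠ 0`, so `Y ∣ p`. Multiplication by `G₆`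
is injective on `M_*`, so powers of `Y` can be cancelled until this contradicts `p ≠ 0`.

Generation: by strong induction on the weight, a form minus a multiple of some `E₄ ^ a * E₆ ^ b` is
a cusp form, hence `Δ` times a form of weight `k - 12`, and `Δ` is a polynomial in `E₄`, `E₆`. The
same division by `Δ` yields `S_* = Δ M_*`. -/

theorem two_mul_riemannZeta_ne_zero {k : ℕ} (hk : 3 ≤ k) : 2 * riemannZeta k ≠ 0 := by
  refine mul_ne_zero two_ne_zero (riemannZeta_ne_zero_of_one_le_re ?_)
  simp only [Complex.natCast_re]
  exact_mod_cast (by omega : 1 ≤ k)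

theorem G_eq {k : ℕ} (hk : 3 ≤ k) : G k hk = (2 * riemannZeta k) • E hk :=
  DFunLike.coe_injective (latticeSum_eq hk)

theorem G₄_eq : G₄ = (2 * riemannZeta (4 : ℕ)) • E₄ := G_eq _

theorem G₆_eq : G₆ = (2 * riemannZeta (6 : ℕ)) • E₆ := G_eq _

/-! ### Evaluation at a point and the values at `i` -/

/-- The linear form `f ↦ f(τ) t ^ k` on the forms of weight `k`. -/
noncomputable def evalAtWeight (τ : ℍ) (t : ℂ) (k : ℤ) : ModularForm 𝒮ℒ k →ₗ[ℂ] ℂ where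
  toFun f := f τ * t ^ k
  map_add' f g := by simp [add_mul]
  map_smul' c f := by simp [mul_assoc]

/-- The algebra homomorphism `F ↦ ∑ F_k(τ) t ^ k`, for a fixed point `τ` and a nonzero `t`. -/
noncomputable def evalAt (τ : ℍ) {t : ℂ} (ht : t ≠ 0) : MStar →ₐ[ℂ] ℂ :=
  DirectSum.toAlgebra ℂ (fun k : ℤ => ModularForm 𝒮ℒ k)
    (evalAtWeight τ t)
    (by
      change (1 : ModularForm 𝒮ℒ 0) τ * t ^ (0 : ℤ) = 1
      simp)
    (fun {i j} f g => by
      change (f τ * g τ) * t ^ (i + j) = (f τ * t ^ i) * (g τ * t ^ j)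
      rw [zpow_add₀ ht]
      ring)

theorem evalAt_of (τ : ℍ) {t : ℂ} (ht : t ≠ 0) (k : ℤ) (f : ModularForm 𝒮ℒ k) :
    evalAt τ ht (DirectSum.of (fun k : ℤ => ModularForm 𝒮ℒ k) k f) = f τ * t ^ k :=
  DirectSum.toAddMonoid_of (β := fun k : ℤ => ModularForm 𝒮ℒ k)
    (fun k => (evalAtWeight τ t k).toAddMonoidHom) k f

/-- `S` fixes `i` with automorphy factor `i ^ 6 = -1`, so the value equals its own negative. -/
theorem E₆_I : E₆ I = 0 := by
  have : SlashInvariantFormClass (ModularForm 𝒮ℒ 6) (CongruenceSubgroup.Gamma 1) 6 :=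
    CongruenceSubgroup.Gamma_one_coe_eq_SL ▸ inferInstance
  have h := SlashInvariantForm.slash_action_eqn_SL'' E₆
    (CongruenceSubgroup.mem_Gamma_one ModularGroup.S) I
  have hS : ModularGroup.S • I = I := by
    rw [modular_S_smul]
    ext
    simp
  have hI : Complex.I ^ (6 : ℤ) = -1 := by
    rw [show Complex.I ^ (6 : ℤ) = Complex.I ^ 6 from zpow_natCast _ 6, Complex.I_pow_eq_pow_mod]
    simp
  rw [hS, ModularGroup.denom_S, coe_I, hI] at h
  linear_combination h / 2

/-- Otherwise `Δ`, a multiple of `E₄ ^ 3 - E₆ ^ 2`, would vanish at `i`. -/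
theorem E₄_I_ne_zero : E₄ I ≠ 0 := by
  intro h
  apply discriminant_ne_zero I
  rw [discriminant_eq_E₄_cube_sub_E₆_sq, h, E₆_I]
  simp

theorem G₆_I : G₆ I = 0 := by
  rw [G₆_eq]
  simp [E₆_I]

theorem G₄_I_ne_zero : G₄ I ≠ 0 := by
  rw [G₄_eq]
  exact mul_ne_zero (two_mul_riemannZeta_ne_zero (by norm_num)) E₄_I_ne_zero

theorem of_mul_apply_add {k : ℤ} (f : ModularForm 𝒮ℒ k) (F : MStar) (j : ℤ) :
    (DirectSum.of (fun k : ℤ => ModularForm 𝒮ℒ k) k f * F) (k + j) = f.mul (F j) := by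
  induction F using DirectSum.induction_on with
  | zero => ext; simp
  | of i g =>
    rw [DirectSum.of_mul_of]
    rcases eq_or_ne i j with rfl | hij
    · rw [DirectSum.of_eq_same, DirectSum.of_eq_same]
      rfl
    · rw [DirectSum.of_eq_of_ne _ _ _ (by simpa using hij.symm),
        DirectSum.of_eq_of_ne _ _ _ hij.symm]
      ext; simp
  | add x y hx hy =>
    rw [mul_add, DirectSum.add_apply, DirectSum.add_apply, hx, hy]
    ext z
    exact (mul_add (f z) (x j z) (y j z)).symm

/-- A homogeneous factor only shifts the grading, so it suffices that a product of two nonzero forms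
is nonzero. -/
theorem of_mul_eq_zero {k : ℤ} {f : ModularForm 𝒮ℒ k} (hf : f ≠ 0) {F : MStar}
    (h : DirectSum.of (fun k : ℤ => ModularForm 𝒮ℒ k) k f * F = 0) : F = 0 := by
  ext1 j
  by_contra hj
  exact ModularForm.mul_ne_zero ⟨1, one_mem_strictPeriods_SL, one_pos⟩ hf hj
    (by rw [← of_mul_apply_add, h]; rfl)

theorem G₆_ne_zero : G₆ ≠ 0 := by
  rw [G₆_eq]
  exact smul_ne_zero (two_mul_riemannZeta_ne_zero (by norm_num)) (E_ne_zero _ ⟨3, rfl⟩)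

/-! ### Algebraic independence -/

/-- The homomorphism `ℂ[X, Y] → M_*` sending `X` to `G₄` and `Y` to `G₆`. -/
noncomputable abbrev polyMap : MvPolynomial (Fin 2) ℂ →ₐ[ℂ] MStar :=
  MvPolynomial.aeval
    ![DirectSum.of (fun k : ℤ => ModularForm 𝒮ℒ k) 4 G₄,
      DirectSum.of (fun k : ℤ => ModularForm 𝒮ℒ k) 6 G₆]

/-- Modulo `Y`, substituting `Y = 0` changes neither generator, hence no polynomial. -/
theorem X_one_dvd_sub (p : MvPolynomial (Fin 2) ℂ) :
    MvPolynomial.X 1 ∣ p - Polynomial.aeval (MvPolynomial.X (0 : Fin 2) : MvPolynomial (Fin 2) ℂ)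
      (MvPolynomial.aeval ![(Polynomial.X : Polynomial ℂ), 0] p) := by
  rw [← Ideal.mem_span_singleton, ← Ideal.Quotient.mk_eq_mk_iff_sub_mem]
  have : Ideal.Quotient.mkₐ ℂ (Ideal.span {(MvPolynomial.X 1 : MvPolynomial (Fin 2) ℂ)}) =
      (Ideal.Quotient.mkₐ ℂ (Ideal.span {(MvPolynomial.X 1 : MvPolynomial (Fin 2) ℂ)})).comp
      ((Polynomial.aeval (MvPolynomial.X (0 : Fin 2) : MvPolynomial (Fin 2) ℂ)).comp
        (MvPolynomial.aeval ![(Polynomial.X : Polynomial ℂ), 0])) := by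
    ext i
    fin_cases i
    · simp
    · simp
  exact DFunLike.congr_fun this p

theorem X_one_dvd_of_polyMap_eq_zero {p : MvPolynomial (Fin 2) ℂ} (hp : polyMap p = 0) :
    MvPolynomial.X 1 ∣ p := by
  have hu : MvPolynomial.aeval ![(Polynomial.X : Polynomial ℂ), 0] p = 0 := by
    refine Polynomial.eq_zero_of_infinite_isRoot _ ((Set.finite_singleton (0 : ℂ)).infinite_compl.mono
      fun y (hy : y ≠ 0) => ?_)
    -- With `t ^ 4 * G₄(i) = y`, evaluation at `i` sends `(G₄, G₆)` to `(y, 0)`.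
    obtain ⟨t, ht⟩ := IsAlgClosed.exists_pow_nat_eq (y / G₄ I) (n := 4) (by norm_num)
    have ht0 : t ≠ 0 := by
      rintro rfl
      exact div_ne_zero hy G₄_I_ne_zero (by simpa using ht.symm)
    have hcomp : (evalAt I ht0).comp polyMap =
        (Polynomial.aeval y).comp (MvPolynomial.aeval ![(Polynomial.X : Polynomial ℂ), 0]) := by
      ext i
      fin_cases i
      · have : G₄ I * t ^ (4 : ℤ) = y := by
          rw [show t ^ (4 : ℤ) = t ^ 4 from zpow_natCast t 4, ht, mul_div_cancel₀ _ G₄_I_ne_zero]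
        simpa [evalAt_of] using this
      · simp [evalAt_of, G₆_I]
    have := DFunLike.congr_fun hcomp p
    simp only [AlgHom.comp_apply, hp, map_zero] at this
    simpa [Polynomial.IsRoot, Polynomial.aeval_def] using this.symm
  simpa [hu] using X_one_dvd_sub p

theorem polyMap_injective : Function.Injective polyMap := by
  rw [injective_iff_map_eq_zero]
  intro p hp
  by_contra hp0
  obtain ⟨n, q, hq, rfl⟩ := WfDvdMonoid.max_power_factor hp0
    (MvPolynomial.X_prime (R := ℂ) (i := (1 : Fin 2))).irreducible
  refine hq (X_one_dvd_of_polyMap_eq_zero ?_)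
  clear hp0
  induction n with
  | zero => simpa using hp
  | succ n ih =>
    apply ih
    rw [pow_succ', mul_assoc, map_mul] at hp
    exact of_mul_eq_zero G₆_ne_zero (by simpa using hp)

/-! ### Generation -/

theorem mem_range_E₄ : DirectSum.of (fun k : ℤ => ModularForm 𝒮ℒ k) 4 E₄ ∈ polyMap.range := by
  have h : E₄ = (2 * riemannZeta (4 : ℕ))⁻¹ • G₄ := by
    rw [G₄_eq, inv_smul_smul₀ (two_mul_riemannZeta_ne_zero (by norm_num))]
  rw [h]
  erw [DirectSum.of_smul]
  exact Subalgebra.smul_mem _ (AlgHom.mem_range _ |>.mpr ⟨MvPolynomial.X 0, by simp⟩) _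

theorem mem_range_E₆ : DirectSum.of (fun k : ℤ => ModularForm 𝒮ℒ k) 6 E₆ ∈ polyMap.range := by
  have h : E₆ = (2 * riemannZeta (6 : ℕ))⁻¹ • G₆ := by
    rw [G₆_eq, inv_smul_smul₀ (two_mul_riemannZeta_ne_zero (by norm_num))]
  rw [h]
  erw [DirectSum.of_smul]
  exact Subalgebra.smul_mem _ (AlgHom.mem_range _ |>.mpr ⟨MvPolynomial.X 1, by simp⟩) _

theorem mem_range_discriminant :
    DirectSum.of (fun k : ℤ => ModularForm 𝒮ℒ k) 12 (CuspForm.toModularFormₗ CuspForm.discriminant)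
      ∈ polyMap.range := by
  have h := discriminant_eq_E₄_cube_sub_E₆_sq_graded
  rw [CuspForm.toModularFormₗ_eq_coe, h]
  exact Subalgebra.smul_mem _
    (sub_mem (pow_mem mem_range_E₄ 3) (pow_mem mem_range_E₆ 2)) _

theorem of_cuspForm_eq {k : ℤ} (f : CuspForm 𝒮ℒ k) :
    DirectSum.of (fun k : ℤ => ModularForm 𝒮ℒ k) k (CuspForm.toModularFormₗ f) =
      DirectSum.of (fun k : ℤ => ModularForm 𝒮ℒ k) 12
          (CuspForm.toModularFormₗ CuspForm.discriminant) *
        DirectSum.of (fun k : ℤ => ModularForm 𝒮ℒ k) (k - 12) (CuspForm.discriminantEquiv f) := by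
  rw [DirectSum.of_mul_of]
  refine DirectSum.of_eq_of_gradedMonoid_eq
    (gradedMonoid_eq_of_cast (by simp [GradedMonoid.mk]) (ModularForm.ext fun z => ?_))
  exact (discriminant_mul_discriminantEquiv_apply f z).symm

/-- In every even weight `k ≥ 4` there is a form with constant term `1` in the range. -/
theorem exists_mem_range_coeff_zero_eq_one {k : ℕ} (hk : 4 ≤ k) (hk2 : Even k) :
    ∃ g : ModularForm 𝒮ℒ (k : ℤ), (qExpansion 1 g).coeff 0 = 1 ∧
      DirectSum.of (fun k : ℤ => ModularForm 𝒮ℒ k) k g ∈ polyMap.range := by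
  obtain ⟨a, b, hab⟩ : ∃ a b : ℕ, k = a * 4 + b * 6 := by
    obtain ⟨m, rfl⟩ := hk2
    -- `k` is `4c` or `4c + 2 = 4(c - 1) + 6`; `k ≥ 4` forces `c ≥ 1` in the second case.
    rcases Nat.even_or_odd' m with ⟨c, rfl | rfl⟩
    · exact ⟨c, 0, by omega⟩
    · exact ⟨c - 1, 1, by omega⟩
  refine ⟨ModularForm.mcast (by rw [hab]; push_cast; rfl) ((E₄.pow a).mul (E₆.pow b)), ?_, ?_⟩
  · rw [ModularForm.qExpansion_mcast, ModularForm.qExpansion_mul one_pos one_mem_strictPeriods_SL,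
      ModularForm.qExpansion_pow one_pos one_mem_strictPeriods_SL,
      ModularForm.qExpansion_pow one_pos one_mem_strictPeriods_SL]
    have h4 := E_qExpansion_coeff_zero (k := 4) (by norm_num) ⟨2, rfl⟩
    have h6 := E_qExpansion_coeff_zero (k := 6) (by norm_num) ⟨3, rfl⟩
    simp only [PowerSeries.coeff_zero_eq_constantCoeff] at h4 h6 ⊢
    simp [h4, h6]
  · have h := mul_mem (pow_mem mem_range_E₄ a) (pow_mem mem_range_E₆ b)
    rw [directSum_of_pow, directSum_of_pow, DirectSum.of_mul_of] at h
    convert h using 1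
    exact DirectSum.of_eq_of_gradedMonoid_eq
      (gradedMonoid_eq_of_cast (by simp [GradedMonoid.mk, hab]) (ModularForm.ext fun z => rfl))

theorem of_mem_range (k : ℕ) (f : ModularForm 𝒮ℒ (k : ℤ)) :
    DirectSum.of (fun k : ℤ => ModularForm 𝒮ℒ k) k f ∈ polyMap.range := by
  induction k using Nat.strong_induction_on with | _ k ih =>
  by_cases hk2 : Even k
  swap
  · rw [levelOne_odd_weight_eq_zero (by exact_mod_cast Nat.not_even_iff_odd.mp hk2) f, map_zero]
    exact zero_mem _
  rcases lt_or_ge k 4 with hk | hk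
  · interval_cases k
    · obtain ⟨c, hc⟩ := ModularFormClass.levelOne_weight_zero_const f
      have : f = ModularForm.const c := DFunLike.coe_injective hc
      rw [this]
      exact polyMap.range.algebraMap_mem c
    · exact absurd hk2 (by decide)
    · rw [rank_zero_iff_forall_zero.mp levelOne_weight_two_rank_zero f, map_zero]
      exact zero_mem _
    · exact absurd hk2 (by decide)
  obtain ⟨g, hg1, hg⟩ := exists_mem_range_coeff_zero_eq_one hk hk2
  obtain ⟨s, hs⟩ := sub_smul_isCuspForm f g hg1
  have hf : f = CuspForm.toModularFormₗ s + (qExpansion 1 f).coeff 0 • g := by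
    rw [hs, sub_add_cancel]
  rw [hf, map_add]
  refine add_mem ?_ ?_
  · rw [of_cuspForm_eq]
    refine mul_mem mem_range_discriminant ?_
    -- Below weight 12 the quotient by `Δ` has negative weight, so it is zero.
    rcases lt_or_ge k 12 with h12 | h12
    · rw [rank_zero_iff_forall_zero.mp (levelOne_neg_weight_rank_zero (by omega))
        (CuspForm.discriminantEquiv s), map_zero]
      exact zero_mem _
    · have h := ih (k - 12) (by omega)
      rw [Nat.cast_sub h12] at h
      exact h _
  · erw [DirectSum.of_smul]
    exact Subalgebra.smul_mem _ hg _

theorem polyMap_surjective : Function.Surjective polyMap := by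
  intro F
  change F ∈ polyMap.range
  induction F using DirectSum.induction_on with
  | zero => exact zero_mem _
  | add x y hx hy => exact add_mem hx hy
  | of k f =>
    rcases lt_or_ge k 0 with hk | hk
    · rw [rank_zero_iff_forall_zero.mp (levelOne_neg_weight_rank_zero hk) f, map_zero]
      exact zero_mem _
    · lift k to ℕ using hk
      exact of_mem_range k f

/-! ### Cusp forms -/

theorem beginsWithQ_discriminant : BeginsWithQ CuspForm.discriminant :=
  ⟨CuspFormClass.qExpansion_coeff_zero CuspForm.discriminant one_pos one_mem_strictPeriods_SL,
    discriminant_qExpansion_coeff_one⟩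

/-- Weight 12 cusp forms are multiples `c • Δ`, and the coefficient of `q` is `c`. -/
theorem BeginsWithQ.eq_discriminant {f : CuspForm 𝒮ℒ 12} (hf : BeginsWithQ f) :
    f = CuspForm.discriminant := by
  obtain ⟨c, rfl⟩ := CuspForm.exists_smul_discriminant_of_weight_eq_twelve f
  have h := hf.2
  rw [FunLike.coe_smul, ModularForm.qExpansion_smul one_pos one_mem_strictPeriods_SL c
    CuspForm.discriminant, PowerSeries.coeff_smul, beginsWithQ_discriminant.2, smul_eq_mul,
    mul_one] at h
  rw [h, one_smul]

theorem coe_SStar_eq_range :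
    (SStar : Set MStar) = Set.range fun F : MStar =>
      DirectSum.of (fun k : ℤ => ModularForm 𝒮ℒ k) 12
        (CuspForm.toModularFormₗ CuspForm.discriminant) * F := by
  ext x
  constructor
  · rintro ⟨y, rfl⟩
    induction y using DirectSum.induction_on with
    | zero => exact ⟨0, by simp⟩
    | of k f =>
      refine ⟨_, (of_cuspForm_eq f).symm.trans ?_⟩
      exact (DirectSum.lmap_of (R := ℂ) (M := fun k : ℤ => CuspForm 𝒮ℒ k)
        (N := fun k : ℤ => ModularForm 𝒮ℒ k) (fun _ => CuspForm.toModularFormₗ) k f).symm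
    | add x y hx hy =>
      obtain ⟨F, hF⟩ := hx
      obtain ⟨F', hF'⟩ := hy
      exact ⟨F + F', by rw [map_add, ← hF, ← hF']; exact mul_add _ _ _⟩
  · rintro ⟨F, rfl⟩
    induction F using DirectSum.induction_on with
    | zero => simp
    | of k f =>
      refine ⟨DirectSum.of (fun k : ℤ => CuspForm 𝒮ℒ k) (12 + k)
        (CuspForm.discriminant.mulModularForm f), ?_⟩
      rw [DirectSum.lmap_of]
      exact (DirectSum.of_mul_of (A := fun k : ℤ => ModularForm 𝒮ℒ k)
        (CuspForm.toModularFormₗ CuspForm.discriminant) f).symm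
    | add x y hx hy =>
      simp only [mul_add]
      exact add_mem hx hy

end LevelOneForms

theorem mainTheorem3 :
    -- the graded algebra of modular forms is the polynomial ring on `G₄` and `G₆`
    Function.Bijective
      (MvPolynomial.aeval
        ![DirectSum.of (fun k : ℤ => ModularForm 𝒮ℒ k) 4 LevelOneForms.G₄,
          DirectSum.of (fun k : ℤ => ModularForm 𝒮ℒ k) 6 LevelOneForms.G₆] :
        MvPolynomial (Fin 2) ℂ →ₐ[ℂ] LevelOneForms.MStar) ∧
    -- `S_12` is one-dimensional
    Module.finrank ℂ (CuspForm 𝒮ℒ 12) = 1 ∧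
    -- `S_12` has exactly one element `Δ = q + O(q²)`; it generates `S_12`, and `S_* = Δ M_*`
    ∃ Δ : CuspForm 𝒮ℒ 12,
      LevelOneForms.BeginsWithQ Δ ∧
      (∀ f : CuspForm 𝒮ℒ 12, LevelOneForms.BeginsWithQ f → f = Δ) ∧
      Submodule.span ℂ {Δ} = ⊤ ∧
      (LevelOneForms.SStar : Set LevelOneForms.MStar) =
        Set.range fun F : LevelOneForms.MStar =>
          DirectSum.of (fun k : ℤ => ModularForm 𝒮ℒ k) 12 (CuspForm.toModularFormₗ Δ) * F := by
  exact ⟨⟨LevelOneForms.polyMap_injective, LevelOneForms.polyMap_surjective⟩,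
    Module.rank_eq_one_iff_finrank_eq_one.mp CuspForm.rank_eq_one_of_weight_eq_twelve,
    CuspForm.discriminant, LevelOneForms.beginsWithQ_discriminant,
    fun _ hf => hf.eq_discriminant,
    Submodule.eq_top_iff'.mpr fun f => Submodule.mem_span_singleton.mpr
      (CuspForm.exists_smul_discriminant_of_weight_eq_twelve f),
    LevelOneForms.coe_SStar_eq_range⟩
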